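/- Let $m\ge 1$ be an integer, $\omega=e^{2i\pi/m}$, and $\omega^{\alpha}:=e^{2i\pi\alpha/m}$ for $\alpha\in\mathbb C$. For $\underline a=(a_1,\dots,a_m)\in\mathbb C^m$ consider $$\Phi''(x)=\frac{P_m(x,\underline a)}{x^2}\,\Phi(x),\qquad P_m(x,\underline a)=x^m+a_1x^{m-1}+\dots+a_m ,$$ on the universal covering of $\mathbb C^*$ (where $x^\alpha=e^{\alpha\ln x}$, with $\ln x$ real for $\arg x=0$). Write $\underline a'=(a_1,\dots,a_{m-1})$ and $c\cdot\underline a=(ca_1,\dots,c^m a_m)$, and similarly $c\cdot\underline a'$. Let $p\in\mathbb C$ with $p^2=1+4a_m$, and $s(p)=\frac{1+p}{2}$. *Solutions at infinity.* Let $\sqrt{P_m(x,\underline a)}=x^{m/2}+\sum_{k\ge1}b_{\frac m2-k}(\underline a)\,x^{\frac m2-k}$ be the expansion at infinity, $b_{m/2}=1$, and put $S(x,\underline a)=\sum_{0\le k<m/2}\frac{b_{m/2-k}(\underline a)}{m/2-k}x^{\frac m2-k}$; put $r(\underline a)=\frac12-\frac m4$ if $m$ is odd and $r(\underline a)=\frac12-\frac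 m4-b_0(\underline a)$ if $m$ is even. $\Phi_0(x,\underline a)$ is the unique solution that has, as $x\to\infty$ in every strict sub-sector of $|\arg x|<3\pi/m$, an asymptotic expansion $x^{r(\underline a)}e^{-S(x,\underline a)}\phi_0$, where $\phi_0$ is a formal power series with constant term $1$ in $x^{-1/2}$ ($m$ odd) or in $x^{-1}$ ($m$ even). Set $\Phi_k(x,\underline a)=\Phi_0(\omega^kx,\omega^k\cdot\underline a)$ for $k\in\mathbb Z$. *Solutions at the origin.* For $p\notin\mathbb Z$ or $p\in\mathbb N^*=\{1,2,\dots\}$, let $f_1,f_2$ and the constant $\lambda(\underline a',p)$ be uniquely determined by: $f_1=x^{s(p)}g_1$ and $f_2=\lambda(\underline a',p)\,f_1\ln x+x^{s(-p)}g_2$ are solutions, $g_1,g_2$ are entire in $x$, $g_1(0)=g_2(0)=1$, and $\lambda(\underline a',p)=0$ if $p\notin\mathbb Z$, while the coefficient of $x^p$ in $g_2$ is $0$ if $p\in\mathbb N^*$. *Connection coefficients.* Let $M_0(\underline a',p)$ be the unique $2\times2$ matrix, independent of $x$, with $\begin{pmatrix}\Phi_{-1}\\ \Phi_0\end{pmatrix}=M_0(\underline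 a',p)\begin{pmatrix}f_1\\ f_2\end{pmatrix}$, and let $(L_0(\underline a',p),\ \tilde L_0(\underline a',p))$ be its first row. **Theorem.** Assume that $\tilde L_0(\omega^k\cdot\underline a',p)\ne0$ for all $k=0,\dots,m-1$. 1. If $p\notin\mathbb Z$, then $$\frac{L_0(\underline a',p)}{\tilde L_0(\underline a',p)}=-i\,\frac{\omega^{-\frac32}\,\omega^{-(m+1)\frac p2}}{p\,\sin(\pi p)}\sum_{k=0}^{m-1}\frac{\omega^{\,r(\omega^k\cdot\underline a)+(k+1)p}}{\tilde L_0(\omega^k\cdot\underline a',p)\,\tilde L_0(\omega^{k+1}\cdot\underline a',p)} .$$ 2. If $p\in\mathbb N^*$, then $$i\pi p\,\omega^{\frac32+\frac p2}\,\lambda(\underline a',p)=\sum_{k=0}^{m-1}\frac{\omega^{\,r(\omega^k\cdot\underline a)+(k+1)p}}{\tilde L_0(\omega^k\cdot\underline a',p)\,\tilde L_0(\omega^{k+1}\cdot\underline a',p)} .$$ -/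

import Mathlib

open Complex

namespace SibuyaFuchs

/-! Functions on the universal covering of `ℂ \ {0}` are written in the coordinate `t`, `x = exp t`
(so `|x| = exp t.re`, `arg x = t.im`, `ln x = t`, `x ^ α = exp (α * t)`). -/

/-- The object determined by the property `Q`: the unique `x` with `Q x`
(and `0` if `Q` does not determine an object). -/
noncomputable def theUnique {α : Type} [Zero α] (Q : α → Prop) : α :=
  open Classical in if h : ∃! x, Q x then h.choose else 0

theorem theUnique_spec {α : Type} [Zero α] {Q : α → Prop} (h : ∃! x, Q x) :
    Q (theUnique Q) := by
  unfold theUnique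
  rw [dif_pos h]
  exact h.choose_spec.1

theorem theUnique_eq {α : Type} [Zero α] {Q : α → Prop} (h : ∃! x, Q x) {x : α} (hx : Q x) :
    theUnique Q = x :=
  h.unique (theUnique_spec h) hx

/-- `ω ^ α = exp (2 π i α / m)`, where `ω = exp (2 π i / m)` has argument `2 π / m`. -/
noncomputable def omegaPow (m : ℕ) (α : ℂ) : ℂ := exp (2 * Real.pi * I * α / m)

/-- `ω = exp (2 π i / m)`. -/
noncomputable def omega (m : ℕ) : ℂ := omegaPow m 1

/-- `c · (a₁, …, aₙ) = (c a₁, …, cⁿ aₙ)`; the entry of index `j : Fin n` is `a_{j+1}`. -/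
def dil {n : ℕ} (c : ℂ) (a : Fin n → ℂ) : Fin n → ℂ := fun j => c ^ ((j : ℕ) + 1) * a j

/-- `a = (a', a_m)` with `a_m = (p ^ 2 - 1) / 4`, that is `p ^ 2 = 1 + 4 a_m`. -/
noncomputable def fullParam {m : ℕ} (a' : Fin (m - 1) → ℂ) (p : ℂ) : Fin m → ℂ :=
  fun j => if h : (j : ℕ) < m - 1 then a' ⟨j, h⟩ else (p ^ 2 - 1) / 4

/-- The coefficient `a_j`, with `a_0 = 1` and `a_j = 0` for `j > m`. -/
noncomputable def polyCoeff {m : ℕ} (a : Fin m → ℂ) (j : ℕ) : ℂ :=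
  if j = 0 then 1 else if h : j - 1 < m then a ⟨j - 1, h⟩ else 0

/-- `P_m(x, a) = x ^ m + a₁ x ^ (m - 1) + ⋯ + a_m`. -/
noncomputable def polyP {m : ℕ} (a : Fin m → ℂ) (x : ℂ) : ℂ :=
  ∑ j ∈ Finset.range (m + 1), polyCoeff a j * x ^ (m - j)

/-- The coefficients of the expansion at infinity of the square root of `P_m`:
`√P_m(x, a) = ∑ k, sqrtCoeff a k * x ^ (m / 2 - k)` with `sqrtCoeff a 0 = 1`,
so `sqrtCoeff a k` is `b_{m/2-k}(a)`. -/
noncomputable def sqrtCoeff {m : ℕ} (a : Fin m → ℂ) : ℕ → ℂ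
  | 0 => 1
  | n + 1 => (polyCoeff a (n + 1)
      - ∑ i : Fin n, sqrtCoeff a ((i : ℕ) + 1) * sqrtCoeff a (n - (i : ℕ))) / 2
  termination_by n => n
  decreasing_by all_goals omega

/-- `sqrtCoeff` is the square root of `1 + a₁ u + ⋯ + a_m u ^ m` as a power series in `u = 1 / x`. -/
theorem sqrtCoeff_sq {m : ℕ} (a : Fin m → ℂ) :
    (PowerSeries.mk (sqrtCoeff a)) ^ 2 = PowerSeries.mk (polyCoeff a) := by
  ext n
  rw [pow_two, PowerSeries.coeff_mul, PowerSeries.coeff_mk,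
    Finset.Nat.sum_antidiagonal_eq_sum_range_succ_mk]
  simp only [PowerSeries.coeff_mk]
  cases n with
  | zero => simp [sqrtCoeff, polyCoeff]
  | succ n =>
    rw [Finset.sum_range_succ, Finset.sum_range_succ']
    have h := sqrtCoeff.eq_2 a n
    have h0 : sqrtCoeff a 0 = 1 := sqrtCoeff.eq_1 a
    rw [Finset.sum_range (n := n)]
    simp only [Nat.sub_zero, Nat.sub_self, h0, Nat.add_sub_add_right]
    rw [h]
    ring

/-- `S(x, a) = ∑_{0 ≤ k < m/2} b_{m/2-k}(a) / (m/2 - k) * x ^ (m/2 - k)` at `x = exp t`;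
its first term is `(2 / m) x ^ (m / 2)`. -/
noncomputable def phaseS {m : ℕ} (a : Fin m → ℂ) (t : ℂ) : ℂ :=
  ∑ k ∈ Finset.range ((m + 1) / 2),
    sqrtCoeff a k / ((m : ℂ) / 2 - k) * exp (((m : ℂ) / 2 - k) * t)

/-- `r(a) = 1/2 - m/4` for `m` odd and `r(a) = 1/2 - m/4 - b_0(a)` for `m` even. -/
noncomputable def expR {m : ℕ} (a : Fin m → ℂ) : ℂ :=
  1 / 2 - (m : ℂ) / 4 - if Even m then sqrtCoeff a (m / 2) else 0

/-- The derivative `d/dx` in the coordinate `t`, `x = exp t`. -/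
noncomputable def dx (φ : ℂ → ℂ) : ℂ → ℂ := fun t => exp (-t) * deriv φ t

/-- `φ` is an analytic solution of `Φ'' = (P_m(x, a) / x ^ 2) Φ` on the universal covering. -/
def IsSolution {m : ℕ} (a : Fin m → ℂ) (φ : ℂ → ℂ) : Prop :=
  Differentiable ℂ φ ∧ ∀ t, dx (dx φ) t = polyP a (exp t) / exp t ^ 2 * φ t

/-- The step of the exponents in the asymptotic series: powers of `x ^ (-1)` for `m` even,
of `x ^ (-1/2)` for `m` odd. -/
noncomputable def step (m : ℕ) : ℝ := if Even m then 1 else 1 / 2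

/-- In every strict sub-sector of `|arg x| < 3 π / m`, `φ` has at infinity the asymptotic expansion
`x ^ r(a) * exp (- S(x, a)) * (1 + ∑_{n ≥ 1} c n * x ^ (- n * step))`, for some coefficients `c`. -/
def HasSubdominantExpansion {m : ℕ} (a : Fin m → ℂ) (φ : ℂ → ℂ) : Prop :=
  ∃ c : ℕ → ℂ, c 0 = 1 ∧ ∀ α : ℝ, α < 3 * Real.pi / m → ∀ N : ℕ, ∃ C R : ℝ,
    ∀ t : ℂ, |t.im| ≤ α → R ≤ t.re →
      ‖φ t * exp (-(expR a * t)) * exp (phaseS a t)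
          - ∑ n ∈ Finset.range N, c n * exp (-(n * (step m : ℂ) * t))‖
        ≤ C * Real.exp (-(N * step m * t.re))

/-- `Φ₀(x, a)`: the unique solution with the above asymptotic expansion. -/
noncomputable def Phi0 {m : ℕ} (a : Fin m → ℂ) : ℂ → ℂ :=
  theUnique fun φ => IsSolution a φ ∧ HasSubdominantExpansion a φ

/-- `Φ_k(x, a) = Φ₀(ω ^ k x, ω ^ k · a)`. -/
noncomputable def Phi {m : ℕ} (k : ℤ) (a : Fin m → ℂ) : ℂ → ℂ :=
  fun t => Phi0 (dil (omega m ^ k) a) (t + 2 * Real.pi * I * k / m)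

/-- `s(p) = (1 + p) / 2`. -/
noncomputable def charExp (p : ℂ) : ℂ := (1 + p) / 2

/-- `(f₁, f₂)`, with the constant `lam`, is the normalized system of solutions at the origin:
`f₁ = x ^ s(p) g₁`, `f₂ = lam * f₁ * ln x + x ^ s(-p) g₂` with `g₁`, `g₂` entire, `g₁(0) = 1`, and
* `lam = 0`, `g₂(0) = 1` if `p` is not an integer;
* `g₂(0) = 1` and the Taylor coefficient of order `p` of `g₂` is `0` if `p` is a positive integer;
* `lam = 1`, `g₂(0) = 0` if `p = 0`. -/
def IsFuchsSystem {m : ℕ} (a' : Fin (m - 1) → ℂ) (p : ℂ) (f₁ f₂ : ℂ → ℂ) (lam : ℂ) : Prop :=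
  IsSolution (fullParam a' p : Fin m → ℂ) f₁ ∧ IsSolution (fullParam a' p : Fin m → ℂ) f₂ ∧
  ∃ g₁ g₂ : ℂ → ℂ, Differentiable ℂ g₁ ∧ Differentiable ℂ g₂ ∧
    (∀ t, f₁ t = exp (charExp p * t) * g₁ (exp t)) ∧
    (∀ t, f₂ t = lam * f₁ t * t + exp (charExp (-p) * t) * g₂ (exp t)) ∧
    g₁ 0 = 1 ∧
    ((∀ n : ℤ, p ≠ n) → lam = 0 ∧ g₂ 0 = 1) ∧
    (∀ n : ℕ, 1 ≤ n → p = n → g₂ 0 = 1 ∧ iteratedDeriv n g₂ 0 = 0) ∧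
    (p = 0 → lam = 1 ∧ g₂ 0 = 0)

/-- The triple `(f₁, f₂, λ)` at `(a', p)`. -/
noncomputable def fuchs (m : ℕ) (a' : Fin (m - 1) → ℂ) (p : ℂ) : (ℂ → ℂ) × (ℂ → ℂ) × ℂ :=
  theUnique fun q => IsFuchsSystem (m := m) a' p q.1 q.2.1 q.2.2

/-- `f₁(x, a', p)`. -/
noncomputable def f1 (m : ℕ) (a' : Fin (m - 1) → ℂ) (p : ℂ) : ℂ → ℂ := (fuchs m a' p).1

/-- `f₂(x, a', p)`. -/
noncomputable def f2 (m : ℕ) (a' : Fin (m - 1) → ℂ) (p : ℂ) : ℂ → ℂ := (fuchs m a' p).2.1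

/-- `λ(a', p)`, the coefficient of `f₁ ln x` in `f₂`. -/
noncomputable def lam (m : ℕ) (a' : Fin (m - 1) → ℂ) (p : ℂ) : ℂ := (fuchs m a' p).2.2

/-- The connection matrix `M_k(a', p)` between the origin and infinity: the unique matrix with
`(Φ_{k-1}, Φ_k)ᵀ = M_k (f₁, f₂)ᵀ`. -/
noncomputable def connMatrix (m : ℕ) (k : ℤ) (a' : Fin (m - 1) → ℂ) (p : ℂ) :
    Matrix (Fin 2) (Fin 2) ℂ :=
  theUnique fun M => ∀ t : ℂ,
    ![Phi (k - 1) (fullParam a' p : Fin m → ℂ) t, Phi k (fullParam a' p : Fin m → ℂ) t]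
      = M.mulVec ![f1 m a' p t, f2 m a' p t]

/-- `L_k(a', p)`, the upper left entry of `M_k`. -/
noncomputable def L (m : ℕ) (k : ℤ) (a' : Fin (m - 1) → ℂ) (p : ℂ) : ℂ :=
  connMatrix m k a' p 0 0

/-- `L̃_k(a', p)`, the upper right entry of `M_k`. -/
noncomputable def Ltilde (m : ℕ) (k : ℤ) (a' : Fin (m - 1) → ℂ) (p : ℂ) : ℂ :=
  connMatrix m k a' p 0 1

/-- The cyclic sum
`∑_{k=0}^{m-1} ω ^ (r(ω^k · a) + (k+1) p) / (L̃₀(ω^k · a', p) L̃₀(ω^{k+1} · a', p))`. -/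
noncomputable def cyclicSum (m : ℕ) (a' : Fin (m - 1) → ℂ) (p : ℂ) : ℂ :=
  ∑ k ∈ Finset.range m,
    omegaPow m (expR (dil (omega m ^ k) (fullParam a' p : Fin m → ℂ)) + ((k : ℂ) + 1) * p) /
      (Ltilde m 0 (dil (omega m ^ k) a') p * Ltilde m 0 (dil (omega m ^ (k + 1)) a') p)

end SibuyaFuchs

namespace SibuyaFuchs

/-! ### Powers of `ω` and dilations -/

/-! The equation is invariant under `x ↦ ωx`, `a ↦ ω · a`, since `P_m` is homogeneous and `ω ^ m =
1`. Hence `Φ₀(x, a) = Φ₋₁(ωx, ω · a)`, and both `Φ₋₁` and `Φ₀` are expressed through first rows of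
`M₀` alone, at `a'` and at `ω · a'`, once it is known how `(f₁, f₂, λ)` transforms (`fuchs_dil`).
The Wronskian of this pair is computed twice: at the origin `W(f₁, f₂) = -p`
(`IsFuchsSystem.wronskian_eq`), and at infinity `W(Φ₋₁, Φ₀) = 2 ω ^ (r(a) - 1)` (from
`wronskian_subdominant`). Dividing the determinant identity by `L̃₀(a') L̃₀(ω · a')` gives a
first-order recurrence for the ratio `L₀ / L̃₀` along the orbit `ω ^ k · a'` (`connection_step`).
Weighted by `ω ^ (k p)`, the recurrence telescopes around the cycle, and periodicity leaves `(1 -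
e^{2πip}) L₀ / L̃₀` and `2πi λ` against the cyclic sum (`connection_sum`). For `p ∉ ℤ` the term in
`λ` vanishes; for `p ∈ ℕ*` the factor `1 - e^{2πip}` does. -/

theorem omegaPow_add (m : ℕ) (α β : ℂ) :
    omegaPow m (α + β) = omegaPow m α * omegaPow m β := by
  unfold omegaPow
  rw [← Complex.exp_add]
  ring_nf

theorem omegaPow_ne_zero (m : ℕ) (α : ℂ) : omegaPow m α ≠ 0 := Complex.exp_ne_zero _

theorem omegaPow_zero (m : ℕ) : omegaPow m 0 = 1 := by simp [omegaPow]

theorem omegaPow_natCast (m k : ℕ) : omegaPow m k = omega m ^ k := by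
  unfold omega omegaPow
  rw [← Complex.exp_nat_mul]
  ring_nf

theorem omegaPow_nat_mul (m k : ℕ) (α : ℂ) : omegaPow m (k * α) = omegaPow m α ^ k := by
  unfold omegaPow
  rw [← Complex.exp_nat_mul]
  ring_nf

theorem omegaPow_self_mul {m : ℕ} (hm : m ≠ 0) (α : ℂ) :
    omegaPow m (m * α) = exp (2 * Real.pi * I * α) := by
  have : (m : ℂ) ≠ 0 := Nat.cast_ne_zero.mpr hm
  unfold omegaPow
  congr 1
  field_simp

theorem omegaPow_half {m : ℕ} (hm : m ≠ 0) : omegaPow m ((m : ℂ) / 2) = -1 := by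
  rw [div_eq_mul_inv, omegaPow_self_mul hm, ← Complex.exp_pi_mul_I]
  ring_nf

theorem omega_ne_zero (m : ℕ) : omega m ≠ 0 := omegaPow_ne_zero m 1

theorem omega_pow_self {m : ℕ} (hm : m ≠ 0) : omega m ^ m = 1 := by
  rw [← omegaPow_natCast, ← mul_one (m : ℂ), omegaPow_self_mul hm, mul_one,
    Complex.exp_two_pi_mul_I]

theorem dil_dil {n : ℕ} (c d : ℂ) (a : Fin n → ℂ) : dil c (dil d a) = dil (c * d) a := by
  funext j
  simp only [dil, mul_pow]
  ring

theorem dil_one {n : ℕ} (a : Fin n → ℂ) : dil 1 a = a := by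
  funext j
  simp [dil]

/-- Only `a_m` encodes `p`, and it is scaled by `c ^ m = 1`, so `p` is constant along the orbit. -/
theorem dil_fullParam {m : ℕ} {c : ℂ} (hc : c ^ m = 1) (a' : Fin (m - 1) → ℂ) (p : ℂ) :
    dil c (fullParam a' p : Fin m → ℂ) = fullParam (dil c a') p := by
  funext j
  by_cases h : (j : ℕ) < m - 1
  · simp [dil, fullParam, h]
  · have hj : (j : ℕ) + 1 = m := by have := j.2; omega
    simp [dil, fullParam, h, hj, hc]

theorem polyCoeff_dil {m : ℕ} (c : ℂ) (a : Fin m → ℂ) (j : ℕ) :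
    polyCoeff (dil c a) j = c ^ j * polyCoeff a j := by
  unfold polyCoeff
  cases j with
  | zero => simp
  | succ j => by_cases h : j < m <;> simp [h, dil]

theorem polyP_dil {m : ℕ} (c : ℂ) (a : Fin m → ℂ) (x : ℂ) :
    polyP (dil c a) (c * x) = c ^ m * polyP a x := by
  unfold polyP
  rw [Finset.mul_sum]
  refine Finset.sum_congr rfl fun j hj => ?_
  have hj : j ≤ m := by simpa [Nat.lt_succ_iff] using hj
  rw [polyCoeff_dil, mul_pow, ← pow_mul_pow_sub c hj]
  ring

theorem sqrtCoeff_dil {m : ℕ} (c : ℂ) (a : Fin m → ℂ) (k : ℕ) :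
    sqrtCoeff (dil c a) k = c ^ k * sqrtCoeff a k := by
  induction k using Nat.strong_induction_on with
  | _ k ih =>
    cases k with
    | zero => simp [sqrtCoeff]
    | succ n =>
      rw [sqrtCoeff, sqrtCoeff, polyCoeff_dil, ← mul_div_assoc, mul_sub, Finset.mul_sum]
      congr 2
      refine Finset.sum_congr rfl fun i _ => ?_
      have hi := i.2
      rw [ih _ (by omega), ih _ (by omega)]
      have : n + 1 = ((i : ℕ) + 1) + (n - i) := by omega
      rw [this, pow_add]
      ring

/-! ### Solutions -/

theorem dx_dx {φ : ℂ → ℂ} (hφ : Differentiable ℂ φ) (t : ℂ) :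
    dx (dx φ) t = (deriv (deriv φ) t - deriv φ t) / exp t ^ 2 := by
  have h1 : HasDerivAt (dx φ)
      (exp (-t) * (-1) * deriv φ t + exp (-t) * deriv (deriv φ) t) t :=
    ((Complex.hasDerivAt_exp (-t)).comp t (hasDerivAt_neg t)).mul
      (hφ.deriv t).hasDerivAt
  have h2 : dx (dx φ) t = exp (-t) * deriv (dx φ) t := rfl
  rw [h2, h1.deriv, Complex.exp_neg]
  field_simp
  ring

theorem isSolution_iff {m : ℕ} (a : Fin m → ℂ) (φ : ℂ → ℂ) :
    IsSolution a φ ↔ Differentiable ℂ φ ∧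
      ∀ t, deriv (deriv φ) t - deriv φ t = polyP a (exp t) * φ t := by
  unfold IsSolution
  refine and_congr_right fun h => forall_congr' fun t => ?_
  rw [dx_dx h, div_mul_eq_mul_div, div_left_inj' (pow_ne_zero 2 (Complex.exp_ne_zero t))]

theorem IsSolution.linearComb {m : ℕ} {a : Fin m → ℂ} {φ ψ : ℂ → ℂ} (hφ : IsSolution a φ)
    (hψ : IsSolution a ψ) (c d : ℂ) : IsSolution a fun t => c * φ t + d * ψ t := by
  rw [isSolution_iff] at *
  obtain ⟨dφ, eφ⟩ := hφ
  obtain ⟨dψ, eψ⟩ := hψ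
  have h1 : deriv (fun t => c * φ t + d * ψ t) = fun t => c * deriv φ t + d * deriv ψ t := by
    funext t
    exact (((dφ t).hasDerivAt.const_mul c).add ((dψ t).hasDerivAt.const_mul d)).deriv
  refine ⟨(dφ.const_mul c).add (dψ.const_mul d), fun t => ?_⟩
  have h2 : deriv (fun t => c * deriv φ t + d * deriv ψ t) t =
      c * deriv (deriv φ) t + d * deriv (deriv ψ) t :=
    (((dφ.deriv t).hasDerivAt.const_mul c).add ((dψ.deriv t).hasDerivAt.const_mul d)).deriv
  rw [h1, h2]
  linear_combination c * eφ t + d * eψ t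

theorem IsSolution.comp_add {m : ℕ} {a : Fin m → ℂ} {φ : ℂ → ℂ} {τ : ℂ}
    (hτ : exp τ ^ m = 1) (hφ : IsSolution (dil (exp τ) a) φ) :
    IsSolution a fun t => φ (t + τ) := by
  rw [isSolution_iff] at *
  obtain ⟨dφ, eφ⟩ := hφ
  refine ⟨dφ.comp (differentiable_id.add_const τ), fun t => ?_⟩
  have h1 : deriv (fun t => φ (t + τ)) = fun t => deriv φ (t + τ) := by
    funext t; exact deriv_comp_add_const _ _ _
  have h2 := polyP_dil (exp τ) a (exp t)
  rw [hτ, one_mul, mul_comm, ← Complex.exp_add] at h2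
  rw [h1, deriv_comp_add_const, eφ, h2]

/-- The Wronskian `φ ψ' - φ' ψ` with respect to `x`, in the coordinate `t`. -/
noncomputable def wronskian (φ ψ : ℂ → ℂ) (t : ℂ) : ℂ :=
  exp (-t) * (φ t * deriv ψ t - deriv φ t * ψ t)

theorem wronskian_const {m : ℕ} {a : Fin m → ℂ} {φ ψ : ℂ → ℂ} (hφ : IsSolution a φ)
    (hψ : IsSolution a ψ) (t s : ℂ) : wronskian φ ψ t = wronskian φ ψ s := by
  rw [isSolution_iff] at *
  obtain ⟨dφ, eφ⟩ := hφ
  obtain ⟨dψ, eψ⟩ := hψ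
  have key : ∀ t, HasDerivAt (wronskian φ ψ) 0 t := fun t => by
    have h := ((Complex.hasDerivAt_exp (-t)).comp t (hasDerivAt_neg t)).mul
      (((dφ t).hasDerivAt.mul (dψ.deriv t).hasDerivAt).sub
        ((dφ.deriv t).hasDerivAt.mul (dψ t).hasDerivAt))
    refine h.congr_deriv ?_
    simp only [Pi.mul_apply, Pi.sub_apply, Function.comp]
    linear_combination (exp (-t) * φ t) * eψ t - (exp (-t) * ψ t) * eφ t
  exact is_const_of_deriv_eq_zero (fun t => (key t).differentiableAt) (fun t => (key t).deriv) t s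

/-- The Wronskian of two linear combinations. -/
theorem wronskian_linearComb {φ ψ : ℂ → ℂ} (dφ : Differentiable ℂ φ) (dψ : Differentiable ℂ ψ)
    (a b c d : ℂ) (t : ℂ) :
    wronskian (fun t => a * φ t + b * ψ t) (fun t => c * φ t + d * ψ t) t =
      (a * d - b * c) * wronskian φ ψ t := by
  have h : ∀ c d : ℂ, deriv (fun t => c * φ t + d * ψ t) t = c * deriv φ t + d * deriv ψ t :=
    fun c d => (((dφ t).hasDerivAt.const_mul c).add ((dψ t).hasDerivAt.const_mul d)).deriv
  simp only [wronskian, h]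
  ring

end SibuyaFuchs

namespace SibuyaFuchs
open Filter Topology

/-! ### The system of solutions at the origin -/

theorem tendsto_exp_ofReal_atBot : Tendsto (fun u : ℝ => exp (u : ℂ)) atBot (𝓝 0) := by
  rw [tendsto_zero_iff_norm_tendsto_zero]
  simpa [Complex.norm_exp] using Real.tendsto_exp_atBot

/-- `W(f₁, f₂) = -p`. -/
theorem IsFuchsSystem.wronskian_eq {m : ℕ} {a' : Fin (m - 1) → ℂ} {p l : ℂ} {f₁ f₂ : ℂ → ℂ}
    (h : IsFuchsSystem (m := m) a' p f₁ f₂ l)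
    (hp : (∀ n : ℤ, p ≠ n) ∨ ∃ n : ℕ, 1 ≤ n ∧ p = n) (t : ℂ) :
    wronskian f₁ f₂ t = -p := by
  obtain ⟨s1, s2, g₁, g₂, dg1, dg2, e1, e2, g10, hN, hI, -⟩ := h
  -- The terms carrying a factor `t` (the logarithm) cancel; of the logarithmic part only `l * f₁ ^
  -- 2 / x` survives, and every other power of `x` cancels because `s(p) + s(-p) = 1`.
  have formula : ∀ t, wronskian f₁ f₂ t = l * exp (p * t) * g₁ (exp t) ^ 2 +
      (g₁ (exp t) * (charExp (-p) * g₂ (exp t) + exp t * deriv g₂ (exp t)) -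
        (charExp p * g₁ (exp t) + exp t * deriv g₁ (exp t)) * g₂ (exp t)) := fun t => by
    have hE : ∀ (s : ℂ) {g : ℂ → ℂ}, Differentiable ℂ g → HasDerivAt
        (fun t => exp (s * t) * g (exp t))
        (exp (s * t) * s * g (exp t) + exp (s * t) * (deriv g (exp t) * exp t)) t := by
      intro s g dg
      have h1 : HasDerivAt (fun t => exp (s * t)) (exp (s * t) * s) t := by
        simpa using (((hasDerivAt_id t).const_mul s).cexp)
      exact h1.mul ((dg _).hasDerivAt.comp t (Complex.hasDerivAt_exp t))
    have d1 := hE (charExp p) dg1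
    rw [← funext e1] at d1
    have d2 := ((d1.const_mul l).mul (hasDerivAt_id t)).add (hE (charExp (-p)) dg2)
    have e2' : f₂ = (fun t => l * f₁ t) * id + fun t => exp (charExp (-p) * t) * g₂ (exp t) := by
      funext t; simp [e2]
    rw [← e2'] at d2
    rw [wronskian, d1.deriv, d2.deriv, e2, e1]
    have x1 : exp (-t) * (exp (charExp p * t) * exp (charExp p * t)) = exp (p * t) := by
      rw [← Complex.exp_add, ← Complex.exp_add, charExp]; ring_nf
    have x2 : exp (-t) * (exp (charExp p * t) * exp (charExp (-p) * t)) = 1 := by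
      rw [← Complex.exp_add, ← Complex.exp_add, charExp, charExp]; ring_nf; exact Complex.exp_zero
    simp only [id]
    linear_combination (l * g₁ (exp t) ^ 2) * x1 +
      (g₁ (exp t) * (charExp (-p) * g₂ (exp t) + exp t * deriv g₂ (exp t)) -
        (charExp p * g₁ (exp t) + exp t * deriv g₁ (exp t)) * g₂ (exp t)) * x2
  have g20 : g₂ 0 = 1 := by
    rcases hp with hp | ⟨n, hn, hp⟩
    · exact (hN hp).2
    · exact (hI n hn hp).1
  -- Either `l = 0`, or `p` is a positive integer and `x ^ p → 0` at the origin.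
  have hlog : Tendsto (fun u : ℝ => l * exp (p * u)) atBot (𝓝 0) := by
    rcases hp with hp | ⟨n, hn, hp⟩
    · simp [(hN hp).1]
    · have : ∀ u : ℝ, l * exp (p * u) = l * exp (u : ℂ) ^ n := fun u => by
        rw [hp, Complex.exp_nat_mul]
      simp only [this]
      simpa [show n ≠ 0 by omega] using (tendsto_exp_ofReal_atBot.pow n).const_mul l
  have hc : ∀ {g : ℂ → ℂ}, Differentiable ℂ g →
      Tendsto (fun u : ℝ => g (exp (u : ℂ))) atBot (𝓝 (g 0)) := fun dg =>
    (dg.continuous.tendsto 0).comp tendsto_exp_ofReal_atBot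
  have hlim : Tendsto (fun u : ℝ => wronskian f₁ f₂ u) atBot (𝓝 (-p)) := by
    simp only [formula]
    have := (hlog.mul ((hc dg1).pow 2)).add
      (((hc dg1).mul (((hc dg2).const_mul (charExp (-p))).add
        (tendsto_exp_ofReal_atBot.mul (hc dg2.deriv)))).sub
      ((((hc dg1).const_mul (charExp p)).add
        (tendsto_exp_ofReal_atBot.mul (hc dg1.deriv))).mul (hc dg2)))
    convert this using 2
    rw [g10, g20, charExp, charExp]
    ring
  have hconst : (fun u : ℝ => wronskian f₁ f₂ u) = fun _ => wronskian f₁ f₂ t :=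
    funext fun u => wronskian_const s1 s2 _ _
  rw [hconst] at hlim
  exact tendsto_nhds_unique tendsto_const_nhds hlim

/-- Dilation of a normalized system at the origin. -/
theorem IsFuchsSystem.dilate {m : ℕ} {a' : Fin (m - 1) → ℂ} {p l : ℂ} {f₁ f₂ : ℂ → ℂ} {τ : ℂ}
    (hτ : exp τ ^ m = 1) (h : IsFuchsSystem (m := m) (dil (exp τ) a') p f₁ f₂ l) :
    IsFuchsSystem (m := m) a' p (fun t => exp (-(charExp p * τ)) * f₁ (t + τ))
      (fun t => exp (-(charExp (-p) * τ)) * f₂ (t + τ) -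
        τ * (exp (p * τ) * l) * (exp (-(charExp p * τ)) * f₁ (t + τ)))
      (exp (p * τ) * l) := by
  obtain ⟨s1, s2, g₁, g₂, dg1, dg2, e1, e2, g10, hN, hI, hZ⟩ := h
  rw [← dil_fullParam hτ] at s1 s2
  have s1' := s1.comp_add hτ
  have s2' := s2.comp_add hτ
  have x1 : ∀ s t : ℂ, exp (-(s * τ)) * exp (s * (t + τ)) = exp (s * t) := fun s t => by
    rw [← Complex.exp_add]; ring_nf
  have x2 : exp (-(charExp (-p) * τ)) = exp (p * τ) * exp (-(charExp p * τ)) := by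
    rw [← Complex.exp_add, charExp, charExp]; ring_nf
  have x3 : ∀ t, exp (t + τ) = exp τ * exp t := fun t => by rw [Complex.exp_add, mul_comm]
  refine ⟨?_, ?_, fun x => g₁ (exp τ * x), fun x => g₂ (exp τ * x),
    dg1.comp (differentiable_id.const_mul _), dg2.comp (differentiable_id.const_mul _),
    ?_, ?_, by simpa using g10, ?_, ?_, ?_⟩
  · simpa using s1'.linearComb s1' (exp (-(charExp p * τ))) 0
  · convert s2'.linearComb s1' (exp (-(charExp (-p) * τ)))
      (-(τ * (exp (p * τ) * l) * exp (-(charExp p * τ)))) using 2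
    ring
  · intro t
    dsimp only
    rw [e1, x3, ← x1 (charExp p) t, mul_assoc]
  · intro t
    dsimp only
    rw [e2, x3, ← x1 (charExp (-p)) t]
    linear_combination (l * f₁ (t + τ) * (t + τ)) * x2
  · intro hp
    simpa using hN hp
  · intro n hn hp
    refine ⟨by simpa using (hI n hn hp).1, ?_⟩
    rw [iteratedDeriv_comp_const_mul dg2.contDiff]
    simp [(hI n hn hp).2]
  · intro hp
    simpa [hp] using hZ hp

end SibuyaFuchs

namespace SibuyaFuchs
open Filter Topology

/-! ### Subdominant solutions at infinity -/

/-- The amplitude `x ^ (-r(a)) * exp (S(x, a)) * φ`. -/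
noncomputable def amplitude {m : ℕ} (a : Fin m → ℂ) (φ : ℂ → ℂ) (t : ℂ) : ℂ :=
  φ t * exp (-(expR a * t)) * exp (phaseS a t)

/-- The derivative of `phaseS a`. -/
noncomputable def phaseDeriv {m : ℕ} (a : Fin m → ℂ) (t : ℂ) : ℂ :=
  ∑ k ∈ Finset.range ((m + 1) / 2), sqrtCoeff a k * exp (((m : ℂ) / 2 - k) * t)

theorem half_sub_ne_zero {m k : ℕ} (hk : k < (m + 1) / 2) : (m : ℂ) / 2 - k ≠ 0 := by
  intro h
  have h2 : (m : ℂ) = ((2 * k : ℕ) : ℂ) := by push_cast; linear_combination 2 * h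
  have := Nat.cast_injective h2
  omega

theorem hasDerivAt_phaseS {m : ℕ} (a : Fin m → ℂ) (t : ℂ) :
    HasDerivAt (phaseS a) (phaseDeriv a t) t := by
  unfold phaseDeriv
  have h : ∀ k ∈ Finset.range ((m + 1) / 2), HasDerivAt
      (fun t => sqrtCoeff a k / ((m : ℂ) / 2 - k) * exp (((m : ℂ) / 2 - k) * t))
      (sqrtCoeff a k * exp (((m : ℂ) / 2 - k) * t)) t := fun k hk => by
    have hk' := half_sub_ne_zero (Finset.mem_range.mp hk)
    have h1 := (((hasDerivAt_id t).const_mul ((m : ℂ) / 2 - k)).cexp).const_mul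
      (sqrtCoeff a k / ((m : ℂ) / 2 - k))
    refine h1.congr_deriv ?_
    simp only [id]
    linear_combination exp (((m : ℂ) / 2 - k) * t) * div_mul_cancel₀ (sqrtCoeff a k) hk'
  exact HasDerivAt.fun_sum h

theorem phaseS_dil {m : ℕ} (a : Fin m → ℂ) (τ t : ℂ) :
    phaseS (dil (exp τ) a) (t + τ) = exp ((m : ℂ) / 2 * τ) * phaseS a t := by
  unfold phaseS
  rw [Finset.mul_sum]
  refine Finset.sum_congr rfl fun k _ => ?_
  have h : exp τ ^ k * exp (((m : ℂ) / 2 - k) * (t + τ)) =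
      exp ((m : ℂ) / 2 * τ) * exp (((m : ℂ) / 2 - k) * t) := by
    rw [← Complex.exp_nat_mul, ← Complex.exp_add, ← Complex.exp_add]
    ring_nf
  rw [sqrtCoeff_dil]
  linear_combination (sqrtCoeff a k / ((m : ℂ) / 2 - k)) * h

/-- For `m` even, `b_0` is homogeneous of degree `m / 2`, so it changes sign and cancels in the sum.
-/
theorem expR_dil {m : ℕ} (a : Fin m → ℂ) {τ : ℂ} (hτ : exp ((m : ℂ) / 2 * τ) = -1) :
    expR (dil (exp τ) a) + expR a = 1 - (m : ℂ) / 2 := by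
  unfold expR
  split_ifs with h
  · obtain ⟨n, hn⟩ := h
    have h2 : m / 2 = n := by omega
    have h3 : exp τ ^ n = -1 := by
      rw [← hτ, ← Complex.exp_nat_mul, hn]
      push_cast
      ring_nf
    rw [sqrtCoeff_dil, h2, h3]
    ring
  · ring

theorem tendsto_line (θ : ℝ) :
    Tendsto (fun u : ℝ => exp (-((u : ℂ) + θ * I))) atTop (𝓝 0) := by
  rw [tendsto_zero_iff_norm_tendsto_zero]
  simpa [Complex.norm_exp] using Real.tendsto_exp_neg_atTop_nhds_zero

theorem tendsto_line_half {m : ℕ} (hm : m ≠ 0) (θ : ℝ) :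
    Tendsto (fun u : ℝ => exp (-((m : ℂ) / 2 * ((u : ℂ) + θ * I)))) atTop (𝓝 0) := by
  rw [tendsto_zero_iff_norm_tendsto_zero]
  have hpos : (0 : ℝ) < m / 2 := by positivity
  have h : ∀ u : ℝ, ‖exp (-((m : ℂ) / 2 * ((u : ℂ) + θ * I)))‖ = Real.exp (-(m / 2 * u)) :=
    fun u => by
      rw [Complex.norm_exp]
      congr 1
      have : (m : ℂ) / 2 = ((m / 2 : ℝ) : ℂ) := by push_cast; rfl
      rw [this, Complex.neg_re, Complex.re_ofReal_mul]
      simp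
  simp only [h]
  exact Real.tendsto_exp_neg_atTop_nhds_zero.comp (tendsto_id.const_mul_atTop hpos)

theorem tendsto_phaseDeriv {m : ℕ} (hm : m ≠ 0) (a : Fin m → ℂ) (θ : ℝ) :
    Tendsto (fun u : ℝ => exp (-((m : ℂ) / 2 * ((u : ℂ) + θ * I))) *
      phaseDeriv a ((u : ℂ) + θ * I)) atTop (𝓝 1) := by
  have h : ∀ u : ℝ, exp (-((m : ℂ) / 2 * ((u : ℂ) + θ * I))) * phaseDeriv a ((u : ℂ) + θ * I) =
      ∑ k ∈ Finset.range ((m + 1) / 2), sqrtCoeff a k * exp (-((u : ℂ) + θ * I)) ^ k := fun u => by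
    unfold phaseDeriv
    rw [Finset.mul_sum]
    refine Finset.sum_congr rfl fun k _ => ?_
    rw [mul_left_comm, ← Complex.exp_add, ← Complex.exp_nat_mul]
    ring_nf
  simp only [h]
  have hsum : ∑ k ∈ Finset.range ((m + 1) / 2), sqrtCoeff a k * (0 : ℂ) ^ k = 1 := by
    obtain ⟨n, hn⟩ : ∃ n, (m + 1) / 2 = n + 1 := ⟨(m + 1) / 2 - 1, by omega⟩
    rw [hn, Finset.sum_range_succ']
    simp [sqrtCoeff.eq_1 a]
  rw [← hsum]
  exact tendsto_finsetSum _ fun k _ => ((tendsto_line θ).pow k).const_mul (sqrtCoeff a k)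

theorem step_pos (m : ℕ) : 0 < step m := by
  unfold step
  split_ifs <;> norm_num

theorem differentiable_amplitude {m : ℕ} (a : Fin m → ℂ) {φ : ℂ → ℂ} (hφ : Differentiable ℂ φ) :
    Differentiable ℂ (amplitude a φ) := by
  have h : Differentiable ℂ (phaseS a) := fun t => (hasDerivAt_phaseS a t).differentiableAt
  unfold amplitude
  fun_prop

/-- The amplitude of a subdominant solution tends to `1`, and its derivative to `0`, along the rays
of the sector. -/
theorem HasSubdominantExpansion.tendsto_amplitude {m : ℕ} {a : Fin m → ℂ} {φ : ℂ → ℂ}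
    (h : HasSubdominantExpansion a φ) (hφ : Differentiable ℂ φ) {θ : ℝ}
    (hθ : |θ| < 3 * Real.pi / m) :
    Tendsto (fun u : ℝ => amplitude a φ ((u : ℂ) + θ * I)) atTop (𝓝 1) ∧
      Tendsto (fun u : ℝ => deriv (amplitude a φ) ((u : ℂ) + θ * I)) atTop (𝓝 0) := by
  obtain ⟨c, hc0, hc⟩ := h
  obtain ⟨α, hα1, hα2⟩ := exists_between hθ
  -- The expansion truncated after its constant term suffices. Since `α > |θ|`, discs of fixed
  -- radius `α - |θ|` in `t` stay in the strip, which allows a Cauchy estimate for the derivative.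
  obtain ⟨C, R, hCR⟩ := hc α hα2 1
  have hs := step_pos m
  have bound : ∀ t : ℂ, |t.im| ≤ α → R ≤ t.re →
      ‖amplitude a φ t - 1‖ ≤ C * Real.exp (-(step m * t.re)) := fun t h1 h2 => by
    simpa [hc0, amplitude] using hCR t h1 h2
  set δ := α - |θ| with hδ
  have hδ0 : 0 < δ := sub_pos.mpr hα1
  have near : ∀ u : ℝ, R + δ ≤ u → ∀ t : ℂ, ‖t - ((u : ℂ) + θ * I)‖ ≤ δ →
      ‖amplitude a φ t - 1‖ ≤ |C| * Real.exp (-(step m * (u - δ))) := fun u hu t ht => by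
    have hre : |t.re - u| ≤ δ := by
      simpa using (Complex.abs_re_le_norm _).trans ht
    have him : |t.im - θ| ≤ δ := by
      simpa using (Complex.abs_im_le_norm _).trans ht
    have h1 : |t.im| ≤ α := by
      have := abs_add_le (t.im - θ) θ
      rw [sub_add_cancel] at this
      linarith
    have h2 := (abs_le.mp hre).1
    refine (bound t h1 (by linarith)).trans ?_
    refine mul_le_mul (le_abs_self C) (Real.exp_le_exp.mpr ?_) (Real.exp_pos _).le (abs_nonneg C)
    nlinarith
  have lim : Tendsto (fun u : ℝ => |C| * Real.exp (-(step m * (u - δ)))) atTop (𝓝 0) := by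
    have h1 : Tendsto (fun u : ℝ => step m * (u - δ)) atTop atTop :=
      (tendsto_atTop_add_const_right atTop (-δ) tendsto_id).const_mul_atTop hs
    simpa using (Real.tendsto_exp_neg_atTop_nhds_zero.comp h1).const_mul |C|
  constructor
  · rw [tendsto_iff_norm_sub_tendsto_zero]
    refine squeeze_zero' (Eventually.of_forall fun _ => norm_nonneg _) ?_ lim
    filter_upwards [eventually_ge_atTop (R + δ)] with u hu
    exact near u hu _ (by simpa using hδ0.le)
  · rw [tendsto_zero_iff_norm_tendsto_zero]
    have lim' := lim.div_const δ
    rw [zero_div] at lim'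
    refine squeeze_zero' (Eventually.of_forall fun _ => norm_nonneg _) ?_ lim'
    filter_upwards [eventually_ge_atTop (R + δ)] with u hu
    rw [← deriv_sub_const (f := amplitude a φ) (1 : ℂ)]
    refine Complex.norm_deriv_le_of_forall_mem_sphere_norm_le hδ0
      ((differentiable_amplitude a hφ).sub_const 1).diffContOnCl fun z hz => ?_
    exact near u hu z (by rw [← dist_eq_norm]; exact (Metric.mem_sphere.mp hz).le)

theorem eq_amplitude_mul {m : ℕ} (a : Fin m → ℂ) (φ : ℂ → ℂ) (t : ℂ) :
    φ t = amplitude a φ t * exp (expR a * t - phaseS a t) := by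
  unfold amplitude
  rw [mul_assoc, mul_assoc, ← Complex.exp_add, ← Complex.exp_add]
  ring_nf
  simp

theorem deriv_eq_amplitude {m : ℕ} (a : Fin m → ℂ) {φ : ℂ → ℂ} (hφ : Differentiable ℂ φ) (t : ℂ) :
    deriv φ t = (deriv (amplitude a φ) t + amplitude a φ t * (expR a - phaseDeriv a t)) *
      exp (expR a * t - phaseS a t) := by
  have h1 : HasDerivAt (fun t => exp (expR a * t - phaseS a t))
      (exp (expR a * t - phaseS a t) * (expR a - phaseDeriv a t)) t := by
    have := ((((hasDerivAt_id t).const_mul (expR a)).sub (hasDerivAt_phaseS a t))).cexp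
    simpa using this
  have h2 := ((differentiable_amplitude a hφ) t).hasDerivAt.mul h1
  have h3 : φ = amplitude a φ * fun t => exp (expR a * t - phaseS a t) := by
    funext t
    exact eq_amplitude_mul a φ t
  rw [← h3] at h2
  rw [h2.deriv]
  ring

theorem phaseDeriv_dil {m : ℕ} (a : Fin m → ℂ) (τ t : ℂ) :
    phaseDeriv (dil (exp τ) a) (t + τ) = exp ((m : ℂ) / 2 * τ) * phaseDeriv a t := by
  unfold phaseDeriv
  rw [Finset.mul_sum]
  refine Finset.sum_congr rfl fun k _ => ?_
  have h : exp τ ^ k * exp (((m : ℂ) / 2 - k) * (t + τ)) =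
      exp ((m : ℂ) / 2 * τ) * exp (((m : ℂ) / 2 - k) * t) := by
    rw [← Complex.exp_nat_mul, ← Complex.exp_add, ← Complex.exp_add]
    ring_nf
  rw [sqrtCoeff_dil]
  linear_combination sqrtCoeff a k * h

/-- The Wronskian of two subdominant solutions of consecutive sectors. -/
theorem wronskian_subdominant {m : ℕ} (hm : m ≠ 0) {a : Fin m → ℂ} {φ ψ : ℂ → ℂ} {τ : ℂ}
    (hτ : τ = -(2 * Real.pi * I / m))
    (sφ : IsSolution (dil (exp τ) a) φ) (eφ : HasSubdominantExpansion (dil (exp τ) a) φ)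
    (sψ : IsSolution a ψ) (eψ : HasSubdominantExpansion a ψ) (t : ℂ) :
    wronskian (fun t => φ (t + τ)) ψ t = -2 * exp (expR (dil (exp τ) a) * τ) := by
  have hm' : (m : ℂ) ≠ 0 := Nat.cast_ne_zero.mpr hm
  have hmR : (0 : ℝ) < m := by positivity
  have hhalf : exp ((m : ℂ) / 2 * τ) = -1 := by
    rw [hτ, show (m : ℂ) / 2 * -(2 * Real.pi * I / m) = -(Real.pi * I) by field_simp,
      Complex.exp_neg, Complex.exp_pi_mul_I]
    norm_num
  have hone : exp τ ^ m = 1 := by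
    rw [← Complex.exp_nat_mul, show (m : ℂ) * τ = m / 2 * τ + m / 2 * τ by ring,
      Complex.exp_add, hhalf]
    norm_num
  set b := dil (exp τ) a with hb
  have sφ' : IsSolution a fun t => φ (t + τ) := sφ.comp_add hone
  have hr : expR b + expR a = 1 - (m : ℂ) / 2 := expR_dil a hhalf
  have hS : ∀ t, phaseS b (t + τ) = -phaseS a t := fun t => by
    rw [hb, phaseS_dil, hhalf, neg_one_mul]
  have hS' : ∀ t, phaseDeriv b (t + τ) = -phaseDeriv a t := fun t => by
    rw [hb, phaseDeriv_dil, hhalf, neg_one_mul]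
  have formula : ∀ t, wronskian (fun t => φ (t + τ)) ψ t = exp (expR b * τ) *
      (exp (-((m : ℂ) / 2 * t)) *
        (amplitude b φ (t + τ) * deriv (amplitude a ψ) t -
          deriv (amplitude b φ) (t + τ) * amplitude a ψ t +
          (expR a - expR b) * (amplitude b φ (t + τ) * amplitude a ψ t)) -
        2 * (exp (-((m : ℂ) / 2 * t)) * phaseDeriv a t) *
          (amplitude b φ (t + τ) * amplitude a ψ t)) := fun t => by
    have hE : exp (-t) * (exp (expR b * (t + τ) - phaseS b (t + τ)) *
        exp (expR a * t - phaseS a t)) = exp (expR b * τ) * exp (-((m : ℂ) / 2 * t)) := by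
      rw [← Complex.exp_add, ← Complex.exp_add, ← Complex.exp_add, hS]
      congr 1
      linear_combination t * hr
    rw [wronskian, deriv_comp_add_const, deriv_eq_amplitude b sφ.1, deriv_eq_amplitude a sψ.1,
      eq_amplitude_mul b φ (t + τ), eq_amplitude_mul a ψ t, hS' t]
    linear_combination (amplitude b φ (t + τ) *
      (deriv (amplitude a ψ) t + amplitude a ψ t * (expR a - phaseDeriv a t)) -
      (deriv (amplitude b φ) (t + τ) + amplitude b φ (t + τ) * (expR b + phaseDeriv a t)) *
        amplitude a ψ t) * hE
  have hπ := Real.pi_pos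
  -- The ray `arg x = π / m` is rotated by `τ` to `arg x = -π / m`, so both solutions are evaluated
  -- inside their sectors.
  have hθ : |Real.pi / m| < 3 * Real.pi / m := by
    rw [abs_of_pos (by positivity)]
    exact div_lt_div_of_pos_right (by linarith) hmR
  obtain ⟨lψ, lψ'⟩ := eψ.tendsto_amplitude sψ.1 hθ
  obtain ⟨lφ, lφ'⟩ := eφ.tendsto_amplitude sφ.1 (θ := -(Real.pi / m)) (by rwa [abs_neg])
  have hline : ∀ u : ℝ, (u : ℂ) + ((-(Real.pi / m) : ℝ) : ℂ) * I =
      (u : ℂ) + ((Real.pi / m : ℝ) : ℂ) * I + τ := fun u => by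
    rw [hτ]
    push_cast
    ring
  simp only [hline] at lφ lφ'
  have hlim : Tendsto (fun u : ℝ => wronskian (fun t => φ (t + τ)) ψ
      ((u : ℂ) + ((Real.pi / m : ℝ) : ℂ) * I)) atTop (𝓝 (-2 * exp (expR b * τ))) := by
    simp only [formula]
    have := ((((tendsto_line_half hm (Real.pi / m)).mul
      (((lφ.mul lψ').sub (lφ'.mul lψ)).add ((lφ.mul lψ).const_mul (expR a - expR b)))).sub
      (((tendsto_phaseDeriv hm a (Real.pi / m)).const_mul 2).mul (lφ.mul lψ))).const_mul
        (exp (expR b * τ)))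
    convert this using 2
    ring
  simp only [wronskian_const sφ' sψ _ t] at hlim
  exact tendsto_nhds_unique tendsto_const_nhds hlim

end SibuyaFuchs

namespace SibuyaFuchs

/-! ### Existence of the normalized objects when `L̃₀` does not vanish -/

/-- The default value of `theUnique` is `0`, so the hypothesis `L̃₀ ≠ 0` by itself forces the
connection matrix, the system at the origin and the needed `Φ₀` to be well defined. -/
theorem existsUnique_of_theUnique_ne_zero {α : Type} [Zero α] {Q : α → Prop}
    (h : theUnique Q ≠ 0) : ∃! x, Q x := by
  by_contra hQ
  exact h (by rw [theUnique, dif_neg hQ])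

theorem connMatrix_spec {m : ℕ} {b : Fin (m - 1) → ℂ} {p : ℂ} (h : Ltilde m 0 b p ≠ 0) :
    ∃! M : Matrix (Fin 2) (Fin 2) ℂ, ∀ t : ℂ,
      ![Phi (0 - 1) (fullParam b p : Fin m → ℂ) t, Phi 0 (fullParam b p : Fin m → ℂ) t]
        = M.mulVec ![f1 m b p t, f2 m b p t] := by
  refine existsUnique_of_theUnique_ne_zero fun h0 => h ?_
  rw [Ltilde, connMatrix, h0]
  rfl

theorem Phi_neg_one_eq {m : ℕ} {b : Fin (m - 1) → ℂ} {p : ℂ} (h : Ltilde m 0 b p ≠ 0) (t : ℂ) :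
    Phi (-1) (fullParam b p : Fin m → ℂ) t =
      L m 0 b p * f1 m b p t + Ltilde m 0 b p * f2 m b p t := by
  have h1 := congrFun (theUnique_spec (connMatrix_spec h) t) 0
  simpa [Matrix.mulVec, dotProduct, Fin.sum_univ_two, L, Ltilde, connMatrix] using h1

theorem fuchs_existsUnique {m : ℕ} {b : Fin (m - 1) → ℂ} {p : ℂ} (h : Ltilde m 0 b p ≠ 0) :
    ∃! q : (ℂ → ℂ) × (ℂ → ℂ) × ℂ, IsFuchsSystem (m := m) b p q.1 q.2.1 q.2.2 := by
  refine existsUnique_of_theUnique_ne_zero fun (h0 : fuchs m b p = 0) => ?_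
  have h1 : ∀ t, f1 m b p t = 0 := fun t => by rw [f1, h0]; rfl
  have h2 : ∀ t, f2 m b p t = 0 := fun t => by rw [f2, h0]; rfl
  obtain ⟨M, hM, hu⟩ := connMatrix_spec h
  -- If `f₁ = f₂ = 0`, every matrix acts in the same way, which contradicts uniqueness.
  have h3 := hu (M + 1) fun t => by
    rw [hM t, h1, h2]
    simp
  exact one_ne_zero (α := Matrix (Fin 2) (Fin 2) ℂ) (add_eq_left.mp h3)

theorem fuchs_spec {m : ℕ} {b : Fin (m - 1) → ℂ} {p : ℂ} (h : Ltilde m 0 b p ≠ 0) :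
    IsFuchsSystem (m := m) b p (f1 m b p) (f2 m b p) (lam m b p) :=
  theUnique_spec (fuchs_existsUnique h)

theorem Phi0_spec {m : ℕ} {b : Fin (m - 1) → ℂ} {p : ℂ} (h : Ltilde m 0 b p ≠ 0) :
    IsSolution (dil (omega m)⁻¹ (fullParam b p : Fin m → ℂ))
        (Phi0 (dil (omega m)⁻¹ (fullParam b p : Fin m → ℂ))) ∧
      HasSubdominantExpansion (dil (omega m)⁻¹ (fullParam b p : Fin m → ℂ))
        (Phi0 (dil (omega m)⁻¹ (fullParam b p : Fin m → ℂ))) := by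
  refine theUnique_spec (existsUnique_of_theUnique_ne_zero
    fun (h0 : Phi0 (dil (omega m)⁻¹ (fullParam b p : Fin m → ℂ)) = 0) => h ?_)
  have h1 : ∀ t, Phi (0 - 1) (fullParam b p : Fin m → ℂ) t = 0 := fun t => by
    rw [Phi, zero_sub, zpow_neg_one, h0]
    rfl
  obtain ⟨M, hM, hu⟩ := connMatrix_spec h
  -- If `Φ₋₁ = 0`, replacing the first row of `M` by zero keeps the relation, so uniqueness gives
  -- `L̃₀ = 0`.
  have h2 := hu (!![0, 0; M 1 0, M 1 1]) fun t => by
    have := congrFun (hM t) 1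
    funext i
    fin_cases i
    · simpa [Matrix.mulVec, dotProduct, Fin.sum_univ_two] using h1 t
    · simpa [Matrix.mulVec, dotProduct, Fin.sum_univ_two] using this
  have h3 : Ltilde m 0 b p = M 0 1 := by
    rw [Ltilde, connMatrix, theUnique_eq (connMatrix_spec h) hM]
  rw [h3, ← h2]
  rfl

/-! ### The relation between consecutive connection coefficients -/

theorem omega_eq_exp (m : ℕ) : omega m = exp (2 * Real.pi * I / m) := by
  simp [omega, omegaPow]

theorem omegaPow_eq_exp (m : ℕ) (α : ℂ) : omegaPow m α = exp (α * (2 * Real.pi * I / m)) := by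
  rw [omegaPow]
  ring_nf

theorem fuchs_dil {m : ℕ} (hm : m ≠ 0) {b : Fin (m - 1) → ℂ} {p : ℂ}
    (hb : Ltilde m 0 b p ≠ 0) (hc : Ltilde m 0 (dil (omega m) b) p ≠ 0) :
    (∀ t, f1 m (dil (omega m) b) p (t + 2 * Real.pi * I / m) =
        omegaPow m (charExp p) * f1 m b p t) ∧
      (∀ t, f2 m (dil (omega m) b) p (t + 2 * Real.pi * I / m) =
        omegaPow m (charExp (-p)) *
          (f2 m b p t + 2 * Real.pi * I / m * lam m b p * f1 m b p t)) ∧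
      lam m b p = omegaPow m p * lam m (dil (omega m) b) p := by
  have hτ : exp (2 * Real.pi * I / m) ^ m = 1 := by rw [← omega_eq_exp, omega_pow_self hm]
  simp only [omegaPow_eq_exp]
  rw [omega_eq_exp] at *
  set τ : ℂ := 2 * Real.pi * I / m
  -- The dilated system at `ω · b` is normalized at `b`, hence is the system at `b`.
  have key := theUnique_eq (fuchs_existsUnique hb)
    (x := (fun t => _, fun t => _, _)) ((fuchs_spec hc).dilate hτ)
  have h1 : f1 m b p = _ := congrArg Prod.fst key
  have h2 : f2 m b p = _ := congrArg (fun q => q.2.1) key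
  have h3 : lam m b p = _ := congrArg (fun q => q.2.2) key
  refine ⟨fun t => ?_, fun t => ?_, h3⟩
  · rw [h1, ← mul_assoc, ← Complex.exp_add]
    simp
  · rw [h1, h2, h3]
    dsimp only
    rw [sub_add_cancel, ← mul_assoc, ← Complex.exp_add]
    simp

theorem connection_step {m : ℕ} (hm : m ≠ 0) {b : Fin (m - 1) → ℂ} {p : ℂ}
    (hp : (∀ n : ℤ, p ≠ n) ∨ ∃ n : ℕ, 1 ≤ n ∧ p = n)
    (hb : Ltilde m 0 b p ≠ 0) (hc : Ltilde m 0 (dil (omega m) b) p ≠ 0) :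
    p * (L m 0 b p / Ltilde m 0 b p -
        omegaPow m p * (L m 0 (dil (omega m) b) p / Ltilde m 0 (dil (omega m) b) p) -
        2 * Real.pi * I / m * lam m b p) =
      -2 * omegaPow m (-(3 / 2) - p / 2) *
        (omegaPow m (expR (fullParam b p : Fin m → ℂ) + p) /
          (Ltilde m 0 b p * Ltilde m 0 (dil (omega m) b) p)) := by
  have hω := omega_ne_zero m
  obtain ⟨k1, k2, -⟩ := fuchs_dil hm hb hc
  obtain ⟨sφ, eφ⟩ := Phi0_spec hb
  obtain ⟨sψ, eψ⟩ := Phi0_spec hc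
  have hback : dil (omega m)⁻¹ (fullParam (dil (omega m) b) p : Fin m → ℂ) = fullParam b p := by
    rw [← dil_fullParam (omega_pow_self hm), dil_dil, inv_mul_cancel₀ hω, dil_one]
  rw [hback] at sψ eψ
  have e1 : (fun t => Phi0 (dil (omega m)⁻¹ (fullParam b p : Fin m → ℂ))
      (t + -(2 * Real.pi * I / m))) =
      fun t => L m 0 b p * f1 m b p t + Ltilde m 0 b p * f2 m b p t := by
    funext t
    rw [← Phi_neg_one_eq hb, Phi, zpow_neg_one]
    congr 1
    push_cast
    ring
  -- `Φ₀(x, a) = Φ₋₁(ωx, ω · a)`: the first row of `M₀` at `ω · b` replaces the second row at `b`.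
  have e2 : Phi0 (fullParam b p : Fin m → ℂ) = fun t =>
      (L m 0 (dil (omega m) b) p * omegaPow m (charExp p) +
        Ltilde m 0 (dil (omega m) b) p * omegaPow m (charExp (-p)) *
          (2 * Real.pi * I / m * lam m b p)) * f1 m b p t +
      (Ltilde m 0 (dil (omega m) b) p * omegaPow m (charExp (-p))) * f2 m b p t := by
    funext t
    have h := Phi_neg_one_eq hc (t + 2 * Real.pi * I / m)
    rw [k1, k2, Phi, zpow_neg_one, hback] at h
    rw [show t + 2 * Real.pi * I / m + 2 * Real.pi * I * ((-1 : ℤ) : ℂ) / m = t by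
      push_cast; ring] at h
    rw [h]
    ring
  have hexp : exp (-(2 * Real.pi * I / m)) = (omega m)⁻¹ := by
    rw [Complex.exp_neg, omega_eq_exp]
  have hW := wronskian_subdominant hm (a := (fullParam b p : Fin m → ℂ)) rfl
    (by rw [hexp]; exact sφ) (by rw [hexp]; exact eφ) sψ eψ 0
  have hs := fuchs_spec hb
  rw [e1, e2, wronskian_linearComb hs.1.1 hs.2.1.1, hs.wronskian_eq hp] at hW
  have hhalf : exp ((m : ℂ) / 2 * -(2 * Real.pi * I / m)) = -1 := by
    rw [mul_neg, Complex.exp_neg, ← omegaPow_eq_exp, omegaPow_half hm]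
    norm_num
  have hr := expR_dil (fullParam b p : Fin m → ℂ) hhalf
  -- Here `r(ω⁻¹ · a) = 1 - m/2 - r(a)`, and `ω ^ (m/2) = -1` accounts for the sign.
  have hR : exp (expR (dil (exp (-(2 * Real.pi * I / m))) (fullParam b p : Fin m → ℂ)) *
      -(2 * Real.pi * I / m)) = -omegaPow m (expR (fullParam b p : Fin m → ℂ) - 1) := by
    rw [eq_sub_of_add_eq hr, ← neg_one_mul (omegaPow _ _), ← omegaPow_half hm, ← omegaPow_add, omegaPow_eq_exp]
    congr 1
    ring
  rw [hR] at hW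
  have x1 : omegaPow m (charExp p) = omegaPow m (charExp (-p)) * omegaPow m p := by
    rw [← omegaPow_add, charExp, charExp]; ring_nf
  have x2 : omegaPow m (charExp (-p)) * (omegaPow m (-(3 / 2) - p / 2) *
      omegaPow m (expR (fullParam b p : Fin m → ℂ) + p)) =
      omegaPow m (expR (fullParam b p : Fin m → ℂ) - 1) := by
    rw [← omegaPow_add, ← omegaPow_add, charExp]; ring_nf
  rw [x1] at hW
  refine mul_left_cancel₀ (mul_ne_zero (omegaPow_ne_zero m (charExp (-p))) (mul_ne_zero hb hc)) ?_
  have y1 := div_mul_cancel₀ (L m 0 b p) hb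
  have y2 := div_mul_cancel₀ (L m 0 (dil (omega m) b) p) hc
  have y3 := div_mul_cancel₀ (omegaPow m (expR (fullParam b p : Fin m → ℂ) + p))
    (mul_ne_zero hb hc)
  generalize L m 0 b p / Ltilde m 0 b p = X at *
  generalize L m 0 (dil (omega m) b) p / Ltilde m 0 (dil (omega m) b) p = Y at *
  generalize omegaPow m (expR (fullParam b p : Fin m → ℂ) + p) /
    (Ltilde m 0 b p * Ltilde m 0 (dil (omega m) b) p) = Z at *
  rw [← y1, ← y2, ← x2, ← y3] at hW
  linear_combination -hW

/-- The telescoped relation. -/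
theorem connection_sum {m : ℕ} (hm : m ≠ 0) {a' : Fin (m - 1) → ℂ} {p : ℂ}
    (hp : (∀ n : ℤ, p ≠ n) ∨ ∃ n : ℕ, 1 ≤ n ∧ p = n)
    (hL : ∀ k : ℕ, k < m → Ltilde m 0 (dil (omega m ^ k) a') p ≠ 0) :
    p * ((1 - exp (2 * Real.pi * I * p)) * (L m 0 a' p / Ltilde m 0 a' p) -
        2 * Real.pi * I * lam m a' p) =
      -2 * omegaPow m (-(3 / 2) - p / 2) * cyclicSum m a' p := by
  have hm' : (m : ℂ) ≠ 0 := Nat.cast_ne_zero.mpr hm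
  have hzero : dil (omega m ^ 0) a' = a' := by rw [pow_zero, dil_one]
  have hself : dil (omega m ^ m) a' = a' := by rw [omega_pow_self hm, dil_one]
  -- The index `k = m` is needed for the last factor of the cyclic sum; there `ω ^ m = 1` returns to
  -- `k = 0`.
  have hL' : ∀ k ≤ m, Ltilde m 0 (dil (omega m ^ k) a') p ≠ 0 := fun k hk => by
    rcases hk.lt_or_eq with hk | hk
    · exact hL k hk
    · have := hL 0 (by omega)
      rw [hzero] at this
      rwa [hk, hself]
  have hsucc : ∀ k, dil (omega m) (dil (omega m ^ k) a') = dil (omega m ^ (k + 1)) a' :=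
    fun k => by rw [dil_dil, pow_succ']
  have hlam : ∀ k ≤ m, omegaPow m p ^ k * lam m (dil (omega m ^ k) a') p = lam m a' p := by
    intro k
    induction k with
    | zero => intro _; rw [hzero, pow_zero, one_mul]
    | succ k ih =>
      intro hk
      have h := (fuchs_dil hm (hL' k (by omega)) (by rw [hsucc]; exact hL' _ hk)).2.2
      rw [hsucc] at h
      rw [← ih (by omega), h]
      ring
  -- The weight `ω ^ (k p)` makes the recurrence telescope, and by `hlam` it also makes its term in
  -- `λ` independent of `k`.
  set X : ℕ → ℂ := fun k => omegaPow m p ^ k *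
    (L m 0 (dil (omega m ^ k) a') p / Ltilde m 0 (dil (omega m ^ k) a') p) with hX
  have hstep : ∀ k ∈ Finset.range m,
      -2 * omegaPow m (-(3 / 2) - p / 2) *
        (omegaPow m (expR (dil (omega m ^ k) (fullParam a' p : Fin m → ℂ)) + ((k : ℂ) + 1) * p) /
          (Ltilde m 0 (dil (omega m ^ k) a') p * Ltilde m 0 (dil (omega m ^ (k + 1)) a') p)) =
      p * ((X k - X (k + 1)) - 2 * Real.pi * I / m * lam m a' p) := fun k hk => by
    have hk := Finset.mem_range.mp hk
    have h := connection_step hm hp (hL' k hk.le) (by rw [hsucc]; exact hL' _ hk)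
    rw [hsucc] at h
    rw [dil_fullParam (by rw [← pow_mul, mul_comm, pow_mul, omega_pow_self hm, one_pow]),
      show ∀ r : ℂ, r + ((k : ℂ) + 1) * p = k * p + (r + p) by intro r; ring, omegaPow_add,
      omegaPow_nat_mul, ← hlam k hk.le, hX]
    linear_combination (-omegaPow m p ^ k) * h
  rw [cyclicSum, Finset.mul_sum, Finset.sum_congr rfl hstep, ← Finset.mul_sum,
    Finset.sum_sub_distrib, Finset.sum_range_sub', Finset.sum_const, Finset.card_range,
    nsmul_eq_mul, hX]
  simp only [hself, pow_zero, one_mul, dil_one]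
  rw [← omegaPow_nat_mul, omegaPow_self_mul hm]
  field_simp

end SibuyaFuchs

/-! ### The two cases of the theorem -/

theorem theorem6p5 (m : ℕ) (hm : 1 ≤ m) (a' : Fin (m - 1) → ℂ) (p : ℂ)
    (hL : ∀ k : ℕ, k < m →
      SibuyaFuchs.Ltilde m 0 (SibuyaFuchs.dil (SibuyaFuchs.omega m ^ k) a') p ≠ 0) :
    ((∀ n : ℤ, p ≠ n) →
      SibuyaFuchs.L m 0 a' p / SibuyaFuchs.Ltilde m 0 a' p =
        -Complex.I * (SibuyaFuchs.omegaPow m (-(3 / 2)) *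
            SibuyaFuchs.omegaPow m (-((m : ℂ) + 1) * (p / 2))) /
          (p * Complex.sin (Real.pi * p)) * SibuyaFuchs.cyclicSum m a' p) ∧
    ((∃ n : ℕ, 1 ≤ n ∧ p = n) →
      Complex.I * Real.pi * p * SibuyaFuchs.omegaPow m (3 / 2 + p / 2) *
          SibuyaFuchs.lam m a' p =
        SibuyaFuchs.cyclicSum m a' p) := by
  open SibuyaFuchs in
  have hm0 : m ≠ 0 := by omega
  have hL0 : Ltilde m 0 a' p ≠ 0 := by
    have := hL 0 (by omega)
    rwa [pow_zero, dil_one] at this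
  constructor
  · intro hp
    have h := connection_sum hm0 (Or.inl hp) hL
    obtain ⟨-, -, g₁, g₂, -, -, -, -, -, hN, -⟩ := fuchs_spec hL0
    rw [(hN hp).1, mul_zero, sub_zero] at h
    have hp0 : p ≠ 0 := by simpa using hp 0
    have hsin : Complex.sin (Real.pi * p) ≠ 0 := fun h0 => by
      obtain ⟨n, hn⟩ := Complex.sin_eq_zero_iff.mp h0
      refine hp n (mul_left_cancel₀ (Complex.ofReal_ne_zero.mpr Real.pi_ne_zero) ?_)
      rw [hn, mul_comm]
    -- `ω ^ (-m p / 2) = e^{-iπp}`, the factor that symmetrizes `1 - e^{2πip}` into a sine in `x2`.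
    have x1 : omegaPow m (-(3 / 2)) * omegaPow m (-((m : ℂ) + 1) * (p / 2)) =
        omegaPow m (-(3 / 2) - p / 2) * exp (-(Real.pi * p * I)) := by
      rw [show (-(Real.pi * p * I) : ℂ) = 2 * Real.pi * I * (-(p / 2)) by ring,
        ← omegaPow_self_mul hm0, ← omegaPow_add, ← omegaPow_add]
      ring_nf
    have x2 : exp (-(Real.pi * p * I)) * (1 - exp (2 * Real.pi * I * p)) =
        -2 * I * Complex.sin (Real.pi * p) := by
      rw [mul_sub, mul_one, ← Complex.exp_add, Complex.sin,
        show -(Real.pi * p * I) + 2 * Real.pi * I * p = Real.pi * p * I by ring,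
        neg_mul (Real.pi * p : ℂ)]
      linear_combination
        (exp (-(Real.pi * p * I)) - exp (Real.pi * p * I)) * Complex.I_sq
    rw [x1, div_mul_eq_mul_div, eq_div_iff (mul_ne_zero hp0 hsin)]
    have h2 := congrArg (fun z => I / 2 * exp (-(Real.pi * p * I)) * z) h
    linear_combination h2 - (I / 2 * p * (L m 0 a' p / Ltilde m 0 a' p)) * x2
      + (p * Complex.sin (Real.pi * p) * (L m 0 a' p / Ltilde m 0 a' p)) * Complex.I_sq
  · intro hp
    have h := connection_sum hm0 (Or.inr hp) hL
    obtain ⟨n, -, hn⟩ := hp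
    have h1 : exp (2 * Real.pi * I * p) = 1 := by
      rw [hn, mul_comm, Complex.exp_nat_mul_two_pi_mul_I]
    have h2 : omegaPow m (3 / 2 + p / 2) * omegaPow m (-(3 / 2) - p / 2) = 1 := by
      rw [← omegaPow_add, ← omegaPow_zero m]
      ring_nf
    rw [h1] at h
    linear_combination (-omegaPow m (3 / 2 + p / 2) / 2) * h + cyclicSum m a' p * h2
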